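/- Theorem 1.1. For elements of a group write $b^g = g^{-1}bg$. A subset $X$ of a group $G$ is called a strong sandwich set if (1) $\langle a, b^g\rangle$ is nilpotent of class at most $2$ for all $a,b\in X$ and $g\in\langle X\rangle$, and (2) $\langle a, b^f, c^g\rangle$ is nilpotent of class at most $3$ for all $a,b,c\in X$ and $f,g\in\langle X\rangle$. (The elements $a,b,c$ need not be distinct.) A group $G$ is called a strong sandwich group if $G=\langle X\rangle$ for some strong sandwich set $X\subseteq G$, finite or not. Every finitely generated strong sandwich group is nilpotent. -/

import Mathlib

/-- The subgroup `H` of `G` is a nilpotent group of nilpotency class at most `n`.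
(Mathlib's `Group.nilpotencyClass` has the junk value `0` on non-nilpotent groups, hence the
first conjunct.) -/
def NilpotentOfClassAtMost {G : Type*} [Group G] (H : Subgroup G) (n : ℕ) : Prop :=
  Group.IsNilpotent H ∧ Group.nilpotencyClass H ≤ n

/-- A subset `X` of a group `G` is a strong sandwich set. The conjugate `b ^ g` is `g⁻¹ * b * g`,
and `a`, `b`, `c` are not required to be distinct. -/
structure IsStrongSandwichSet {G : Type*} [Group G] (X : Set G) : Prop where
  two : ∀ a ∈ X, ∀ b ∈ X, ∀ g ∈ Subgroup.closure X,
    NilpotentOfClassAtMost (Subgroup.closure {a, g⁻¹ * b * g}) 2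
  three : ∀ a ∈ X, ∀ b ∈ X, ∀ c ∈ X, ∀ f ∈ Subgroup.closure X, ∀ g ∈ Subgroup.closure X,
    NilpotentOfClassAtMost (Subgroup.closure {a, f⁻¹ * b * f, g⁻¹ * c * g}) 3

/-- A group is a strong sandwich group if it is generated by some strong sandwich set
(finite or not). -/
def IsStrongSandwichGroup (G : Type*) [Group G] : Prop :=
  ∃ X : Set G, IsStrongSandwichSet X ∧ Subgroup.closure X = ⊤

/-!
The proof has three ingredients.

*Closure.* Let `C` consist of all iterated commutators of conjugates of elements of a strong
sandwich set `X` generating `G`. The sandwich relations persist on `C`: for `a`, `b`, `c` in `C`,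
`⁅a, b⁆` commutes with `b`, and `⁅⁅a, b⁆, c⁆` commutes with `a`, `b` and `c`. This is an induction
on the total number of brackets (`SandwichUpTo.succ`); the relations for a triple with an entry
`⁅a, b⁆` follow from relations for triples formed from `a`, `b` and the two other entries, the
crucial case being `SandwichUpTo.triple_commutator_left₃`. On the way one obtains a Jacobi
identity without error terms, `SandwichUpTo.jacobi`. In particular `⁅⁅c, a⁆, b⁆ = ⁅c, ⁅a, b⁆⁆` if
`c` commutes with `b`.

*Termination.* Fix a finite list `Y` in `C`, and replace `b` by `⁅b, x⁆` for the first letter `x`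
of `Y` not commuting with `b`, as long as there is one. The number of steps is bounded, uniformly
in `b ∈ C` (`IsSandwichSystem.not_long`). Otherwise some list `Y ++ [p]` has unbounded runs while
`Y` has not. Contracting each use of `p` with the following letter `z` into the single letter
`⁅p, z⁆`, one finds another such pair, with `Y` extended by letters `⁅p, z⁆` and `p` replaced by
`⁅p, v⁆`, `v ∈ Y`. The finite set of letters `q` of `Y` for which some `⁅b, q⁆`, `b ∈ C`, is an
element where `p` is used next does not grow under this operation, and the letter `v` is not in
the new set. Starting from a pair for which this set is minimal and iterating, the letters `v` are
never in the set, and this forces `⁅c, p⁆`, for any `c` where the current `p` is used, to be the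
end of a run over the original list; so that list has unbounded runs as well.

*Nilpotency.* Let `T ⊆ X` be a finite generating set. Modulo the hypercenter (the union of the
upper central series), an element of `C` commuting with all of `T` is trivial. If `C` had
nontrivial image there, runs over `T` would never end. So `T` lies in the hypercenter, hence,
being finite, in some term of the upper central series, which is then the whole group.
-/

namespace StrongSandwich

open scoped commutatorElement

/-! ### Commutator identities -/

section Commutators
variable {G : Type*} [Group G]

theorem commutator_mul_right (c x y : G) : ⁅c, x * y⁆ = ⁅c, x⁆ * (x * ⁅c, y⁆ * x⁻¹) := by
  simp only [commutatorElement_def]; group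

theorem commutator_mul_left (x y c : G) : ⁅x * y, c⁆ = x * ⁅y, c⁆ * x⁻¹ * ⁅x, c⁆ := by
  simp only [commutatorElement_def]; group

theorem conj_eq_commutator_mul (g x : G) : g * x * g⁻¹ = ⁅g, x⁆ * x := by
  simp only [commutatorElement_def]; group

theorem _root_.Commute.commutatorElement_right {u x y : G} (hx : Commute u x) (hy : Commute u y) :
    Commute u ⁅x, y⁆ := by
  rw [commutatorElement_def]
  exact ((hx.mul_right hy).mul_right hx.inv_right).mul_right hy.inv_right

theorem _root_.Commute.conj_eq {u x : G} (h : Commute u x) : u * x * u⁻¹ = x := by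
  rw [h.eq, mul_inv_cancel_right]

theorem _root_.Commute.commutatorElement_swap {u x y : G} (h : Commute u ⁅x, y⁆) :
    Commute u ⁅y, x⁆ := by
  rw [← commutatorElement_inv]; exact h.inv_right

theorem _root_.Commute.commutatorElement_swap_left {u x y : G} (h : Commute ⁅x, y⁆ u) :
    Commute ⁅y, x⁆ u :=
  h.symm.commutatorElement_swap.symm

/-- The sandwich relation makes conjugation by `e` a left multiplication by `⁅c, e⁆`. -/
theorem inv_conj_eq {c e : G} (h : Commute ⁅c, e⁆ e) : e⁻¹ * c * e = ⁅c, e⁆ * c := by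
  have h1 : e⁻¹ * (⁅c, e⁆ * e) = ⁅c, e⁆ := by rw [h.eq, inv_mul_cancel_left]
  have h2 : e⁻¹ * c * e = e⁻¹ * (⁅c, e⁆ * e) * c := by simp only [commutatorElement_def]; group
  rw [h2, h1]

theorem commutator_inv_left_of_commute {u c : G} (h : Commute ⁅u, c⁆ u) : ⁅u⁻¹, c⁆ = ⁅u, c⁆⁻¹ := by
  have h1 : ⁅u⁻¹, c⁆ = u⁻¹ * ⁅u, c⁆⁻¹ * u := by simp only [commutatorElement_def]; group
  rw [h1, mul_assoc, h.inv_left.eq, inv_mul_cancel_left]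

theorem commutator_inv_right_of_commute {u c : G} (h : Commute ⁅c, u⁆ u) : ⁅c, u⁻¹⁆ = ⁅c, u⁆⁻¹ := by
  have h1 : ⁅c, u⁻¹⁆ = u⁻¹ * ⁅c, u⁆⁻¹ * u := by simp only [commutatorElement_def]; group
  rw [h1, mul_assoc, h.inv_left.eq, inv_mul_cancel_left]

/-- Holds because `⁅k, d⁆ = k * (d * k * d⁻¹)⁻¹`. Together with `inv_conj_eq` this reduces the
centralising statements below to commutation of shorter commutators. -/
theorem commute_commutatorElement_of_commute_conj {k d c : G} (h1 : Commute k c)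
    (h2 : Commute k (d⁻¹ * c * d)) : Commute ⁅k, d⁆ c := by
  have h3 : Commute (d * k * d⁻¹) c := by
    have h := (Commute.conj_iff d).2 h2
    have e : d * (d⁻¹ * c * d) * d⁻¹ = c := by group
    rwa [e] at h
  have h4 : ⁅k, d⁆ = k * (d * k * d⁻¹)⁻¹ := by simp only [commutatorElement_def]; group
  rw [h4]; exact h1.mul_left h3.inv_left

end Commutators

/-! ### Sandwich relations among commutators of bounded size -/

section Family
variable {G : Type*} [Group G]

/-- `SandwichUpTo S N` says that elements of the conjugation-invariant sets `S i` (the elements of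
"size" `i`) satisfy the class-two relation in pairs of total size at most `N`, and the class-three
relation in triples of total size at most `N`, each in the form: the left-normed commutator
commutes with every entry. -/
structure SandwichUpTo (S : ℕ → Set G) (N : ℕ) : Prop where
  conj : ∀ {i : ℕ} {a : G} (g : G), a ∈ S i → g * a * g⁻¹ ∈ S i
  pair : ∀ {i j : ℕ} {a b : G}, i + j ≤ N → a ∈ S i → b ∈ S j → Commute ⁅a, b⁆ b
  triple₁ : ∀ {i j k : ℕ} {a b c : G}, i + j + k ≤ N → a ∈ S i → b ∈ S j → c ∈ S k →
    Commute ⁅⁅a, b⁆, c⁆ a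
  triple₂ : ∀ {i j k : ℕ} {a b c : G}, i + j + k ≤ N → a ∈ S i → b ∈ S j → c ∈ S k →
    Commute ⁅⁅a, b⁆, c⁆ b
  triple₃ : ∀ {i j k : ℕ} {a b c : G}, i + j + k ≤ N → a ∈ S i → b ∈ S j → c ∈ S k →
    Commute ⁅⁅a, b⁆, c⁆ c

namespace SandwichUpTo
variable {S : ℕ → Set G} {N i j k l : ℕ} {a b c d : G} (hS : SandwichUpTo S N)
include hS

theorem pair_left (h : i + j ≤ N) (ha : a ∈ S i) (hb : b ∈ S j) : Commute ⁅a, b⁆ a :=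
  (hS.pair (by omega) hb ha).commutatorElement_swap_left

theorem commute_right (h : i + j + k ≤ N) (ha : a ∈ S i) (hb : b ∈ S j) (hc : c ∈ S k) :
    Commute ⁅a, c⁆ ⁅b, c⁆ := by
  have h1 : Commute ⁅a, c⁆ c := hS.pair (by omega) ha hc
  have h2 : Commute ⁅⁅a, c⁆, b⁆ c := hS.triple₂ (by omega) ha hc hb
  have h3 : Commute ⁅⁅a, c⁆, b⁆ b := hS.triple₃ (by omega) ha hc hb
  have h4 : ⁅a, c⁆ * ⁅b, c⁆ * ⁅a, c⁆⁻¹ = ⁅b, c⁆ := by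
    rw [conjugate_commutatorElement, h1.conj_eq, conj_eq_commutator_mul,
      commutator_mul_left, commutatorElement_eq_one_iff_commute.2 h2, mul_one,
      (h3.commutatorElement_right h2).conj_eq]
  exact mul_inv_eq_iff_eq_mul.1 h4

theorem commute_left (h : i + j + k ≤ N) (ha : a ∈ S i) (hb : b ∈ S j) (hc : c ∈ S k) :
    Commute ⁅c, a⁆ ⁅c, b⁆ :=
  (hS.commute_right h ha hb hc).commutatorElement_swap.commutatorElement_swap_left

/-- From `⁅a, b⁆ = a * (b * a * b⁻¹)⁻¹`; it turns a commutator with `⁅a, b⁆` into commutators with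
two conjugates of `a`, which commute with each other. -/
theorem commutator_commutator_eq (h : i + j + k ≤ N) (ha : a ∈ S i) (hb : b ∈ S j)
    (hc : c ∈ S k) : ⁅c, ⁅a, b⁆⁆ = ⁅c, b * a * b⁻¹⁆⁻¹ * ⁅c, a⁆ := by
  have hba : b * a * b⁻¹ = ⁅b, a⁆ * a := conj_eq_commutator_mul b a
  have h1 : Commute a (b * a * b⁻¹) := by
    rw [hba]
    exact (hS.pair (by omega) hb ha).symm.mul_right (Commute.refl a)
  have h2 : Commute ⁅c, a⁆ (b * a * b⁻¹) := by
    rw [hba]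
    exact (hS.commute_right (by omega) hc hb ha).mul_right (hS.pair (by omega) hc ha)
  have h3 : Commute ⁅c, b * a * b⁻¹⁆ (b * a * b⁻¹) := hS.pair (by omega) hc (hS.conj b ha)
  have h4 : ⁅a, b⁆ = a * (b * a * b⁻¹)⁻¹ := by simp only [commutatorElement_def]; group
  rw [h4]
  generalize b * a * b⁻¹ = a' at h1 h2 h3
  have h5 : a * ⁅c, a'⁆ * a⁻¹ = ⁅c, a⁆⁻¹ * ⁅c, a'⁆ * ⁅c, a⁆ := by
    have h6 : a * c * a⁻¹ = ⁅c, a⁆⁻¹ * c := by simp only [commutatorElement_def]; group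
    rw [conjugate_commutatorElement, h1.conj_eq, h6, commutator_mul_left,
      commutatorElement_eq_one_iff_commute.2 h2.inv_left, mul_one, inv_inv]
  have h7 : a * ⁅c, a'⁆⁻¹ * a⁻¹ = (a * ⁅c, a'⁆ * a⁻¹)⁻¹ := by group
  rw [commutator_mul_right, commutator_inv_right_of_commute h3, h7, h5]
  group

theorem commute_commutator_commutator (h : i + j + k + l ≤ N) (ha : a ∈ S i) (hb : b ∈ S j)
    (hc : c ∈ S k) (hd : d ∈ S l) : Commute ⁅c, d⁆ ⁅c, ⁅a, b⁆⁆ := by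
  rw [hS.commutator_commutator_eq (by omega) ha hb hc]
  exact (hS.commute_left (by omega) hd (hS.conj b ha) hc).inv_right.mul_right
    (hS.commute_left (by omega) hd ha hc)

theorem swap_left (h : i + j + k ≤ N) (ha : a ∈ S i) (hb : b ∈ S j) (hc : c ∈ S k) :
    ⁅⁅b, c⁆, a⁆ = ⁅a, ⁅c, b⁆⁆ := by
  have h1 : Commute ⁅⁅c, b⁆, a⁆ ⁅c, b⁆ :=
    (hS.triple₁ (by omega) hc hb ha).commutatorElement_right (hS.triple₂ (by omega) hc hb ha)
  rw [← commutatorElement_inv c b, commutator_inv_left_of_commute h1, commutatorElement_inv]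

/-- A multiplicative Jacobi identity. -/
theorem jacobi (h : i + j + k ≤ N) (ha : a ∈ S i) (hb : b ∈ S j) (hc : c ∈ S k) :
    ⁅c, ⁅a, b⁆⁆ = ⁅⁅b, c⁆, a⁆ * ⁅⁅c, a⁆, b⁆ := by
  have h1 : Commute ⁅b, c⁆ ⁅c, b * a * b⁻¹⁆ :=
    (hS.commute_left (by omega) hb (hS.conj b ha) hc).commutatorElement_swap_left
  have h2 : ⁅⁅b, c⁆, b * a * b⁻¹⁆ = ⁅⁅b, c⁆, a⁆ := by
    have h3 : b * ⁅b, c⁆ * b⁻¹ = ⁅b, c⁆ := (hS.pair_left (by omega) hb hc).symm.conj_eq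
    have h4 : b * ⁅⁅b, c⁆, a⁆ * b⁻¹ = ⁅⁅b, c⁆, a⁆ :=
      (hS.triple₁ (by omega) hb hc ha).symm.conj_eq
    rw [conjugate_commutatorElement, h3] at h4
    exact h4
  have h5 : b * ⁅c, a⁆ * b⁻¹ = ⁅c, b * a * b⁻¹⁆ * ⁅⁅b, c⁆, a⁆ := by
    rw [conjugate_commutatorElement, conj_eq_commutator_mul b c, commutator_mul_left,
      h1.conj_eq, h2]
  have h6 : ⁅⁅c, a⁆, b⁆ = ⁅c, a⁆ * (b * ⁅c, a⁆ * b⁻¹)⁻¹ := by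
    simp only [commutatorElement_def]; group
  have h7 : Commute ⁅⁅b, c⁆, a⁆ ⁅c, a⁆ :=
    (hS.triple₂ (by omega) hb hc ha).commutatorElement_right (hS.triple₃ (by omega) hb hc ha)
  have h8 : Commute ⁅c, a⁆ ⁅c, b * a * b⁻¹⁆ := by
    rw [conj_eq_commutator_mul b a]
    exact (hS.pair_left (by omega) hc ha).commutatorElement_right
      ((hS.commute_right (by omega) hc hb ha).mul_right (hS.pair (by omega) hc ha))
  rw [hS.commutator_commutator_eq h ha hb hc, h6, h5, mul_inv_rev, ← mul_assoc, ← mul_assoc,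
    h7.eq, mul_assoc ⁅c, a⁆, mul_inv_cancel, mul_one, h8.inv_right.eq]

theorem commute_two_pairs₁ (h : i + j + k + l ≤ N) (ha : a ∈ S i) (hb : b ∈ S j)
    (hc : c ∈ S k) (hd : d ∈ S l) : Commute ⁅⁅c, d⁆, ⁅a, b⁆⁆ c := by
  have h1 : Commute ⁅c, ⁅a, b⁆⁆ ⁅a, b⁆ :=
    (((hS.triple₁ (by omega) ha hb hc).commutatorElement_right
      (hS.triple₂ (by omega) ha hb hc))).commutatorElement_swap_left
  refine commute_commutatorElement_of_commute_conj (hS.pair_left (by omega) hc hd) ?_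
  rw [inv_conj_eq h1]
  exact (hS.commute_commutator_commutator h ha hb hc hd).mul_right
    (hS.pair_left (by omega) hc hd)

theorem commute_two_pairs₂ (h : i + j + k + l ≤ N) (ha : a ∈ S i) (hb : b ∈ S j)
    (hc : c ∈ S k) (hd : d ∈ S l) : Commute ⁅⁅c, d⁆, ⁅a, b⁆⁆ d := by
  have h1 : Commute ⁅d, ⁅a, b⁆⁆ ⁅a, b⁆ :=
    (((hS.triple₁ (by omega) ha hb hd).commutatorElement_right
      (hS.triple₂ (by omega) ha hb hd))).commutatorElement_swap_left
  refine commute_commutatorElement_of_commute_conj (hS.pair (by omega) hc hd) ?_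
  rw [inv_conj_eq h1]
  exact (hS.commute_commutator_commutator (by omega) ha hb hd
    hc).commutatorElement_swap_left.mul_right (hS.pair (by omega) hc hd)

theorem commute_two_pairs₃ (h : i + j + k + l ≤ N) (ha : a ∈ S i) (hb : b ∈ S j)
    (hc : c ∈ S k) (hd : d ∈ S l) : Commute ⁅⁅c, d⁆, ⁅a, b⁆⁆ ⁅a, b⁆ :=
  (hS.commute_two_pairs₁ (by omega) hc hd ha
    hb).commutatorElement_swap_left.commutatorElement_right
    (hS.commute_two_pairs₂ (by omega) hc hd ha hb).commutatorElement_swap_left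

theorem commute_common_right (h : i + j + k + l ≤ N) (ha : a ∈ S i) (hb : b ∈ S j)
    (hc : c ∈ S k) (hd : d ∈ S l) : Commute ⁅b, ⁅c, a⁆⁆ ⁅b, ⁅d, a⁆⁆ := by
  rw [hS.commutator_commutator_eq (by omega) hc ha hb,
    hS.commutator_commutator_eq (by omega) hd ha hb]
  have hc' := hS.conj a hc
  have hd' := hS.conj a hd
  exact ((hS.commute_left (by omega) hc' hd' hb).inv_inv.mul_right
    (hS.commute_left (by omega) hc' hd hb).inv_left).mul_left
    ((hS.commute_left (by omega) hc hd' hb).inv_right.mul_right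
      (hS.commute_left (by omega) hc hd hb))

/-- By the Jacobi identity `⁅c, ⁅a, b⁆⁆` is the product of `⁅⁅b, c⁆, a⁆` and `⁅⁅c, a⁆, b⁆`, and
each factor commutes with each of the two factors of `⁅d, ⁅a, b⁆⁆`. -/
theorem commute_common_commutator (h : i + j + k + l ≤ N) (ha : a ∈ S i) (hb : b ∈ S j)
    (hc : c ∈ S k) (hd : d ∈ S l) : Commute ⁅c, ⁅a, b⁆⁆ ⁅d, ⁅a, b⁆⁆ := by
  -- The first factor commutes with `b`, and, written as `⁅a, ⁅c, b⁆⁆`, also with `⁅a, d⁆`.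
  have cross : ∀ {k l : ℕ} {c d : G}, i + j + k + l ≤ N → c ∈ S k → d ∈ S l →
      Commute ⁅⁅b, c⁆, a⁆ ⁅⁅d, a⁆, b⁆ := by
    intro k l c d h hc hd
    refine Commute.commutatorElement_right ?_ (hS.triple₁ (by omega) hb hc ha)
    rw [hS.swap_left (by omega) ha hb hc]
    exact (hS.commute_commutator_commutator (by omega) hc hb ha
      hd).symm.commutatorElement_swap
  have hX : Commute ⁅⁅b, c⁆, a⁆ ⁅⁅b, d⁆, a⁆ := by
    rw [hS.swap_left (by omega) ha hb hc, hS.swap_left (by omega) ha hb hd]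
    exact hS.commute_common_right (by omega) hb ha hc hd
  have hY : Commute ⁅⁅c, a⁆, b⁆ ⁅⁅d, a⁆, b⁆ :=
    (hS.commute_common_right (by omega) ha hb hc
      hd).commutatorElement_swap.commutatorElement_swap_left
  rw [hS.jacobi (by omega) ha hb hc, hS.jacobi (by omega) ha hb hd]
  exact (hX.mul_right (cross h hc hd)).mul_left ((cross (by omega) hd hc).symm.mul_right hY)

section
variable (h : i + j + k + l ≤ N) (ha : a ∈ S i) (hb : b ∈ S j) (hc : c ∈ S k) (hd : d ∈ S l)
include h ha hb hc hd

/-- With the next two lemmas: the triple `(⁅a, b⁆, c, d)` satisfies the class-three relation as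
soon as the shorter triples formed from `a`, `b`, `c`, `d` do. -/
theorem triple_commutator_left₂ : Commute ⁅⁅⁅a, b⁆, c⁆, d⁆ c := by
  have h1 : Commute ⁅⁅a, b⁆, c⁆ c := hS.triple₃ (by omega) ha hb hc
  refine commute_commutatorElement_of_commute_conj h1 ?_
  rw [inv_conj_eq (hS.pair (by omega) hc hd)]
  exact (hS.commute_commutator_commutator h ha hb hc
    hd).symm.commutatorElement_swap_left.mul_right h1

theorem triple_commutator_left₁ : Commute ⁅⁅⁅a, b⁆, c⁆, d⁆ ⁅a, b⁆ := by
  have h1 : Commute ⁅⁅a, b⁆, c⁆ ⁅a, b⁆ := (hS.triple₁ (by omega) ha hb hc).commutatorElement_right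
    (hS.triple₂ (by omega) ha hb hc)
  refine commute_commutatorElement_of_commute_conj h1 ?_
  rw [inv_conj_eq (hS.triple₃ (by omega) ha hb hd)]
  exact (hS.commute_common_commutator h ha hb hc
    hd).commutatorElement_swap.commutatorElement_swap_left.mul_right h1

/-- The hardest of the relations: conjugating `⁅a, b⁆` by `c` replaces `a` and `b` by conjugates,
so the triple `(c * a * c⁻¹, c * b * c⁻¹, d)` can be used, and `⁅⁅a, b⁆, c⁆` is the quotient of
`⁅a, b⁆` by this conjugate. -/
theorem triple_commutator_left₃ : Commute ⁅⁅⁅a, b⁆, c⁆, d⁆ d := by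
  have hca := hS.conj c ha
  have hcb := hS.conj c hb
  have hed : Commute ⁅⁅a, b⁆, d⁆ d := hS.triple₃ (by omega) ha hb hd
  have hede : Commute ⁅⁅a, b⁆, d⁆ ⁅a, b⁆ :=
    (hS.triple₁ (by omega) ha hb hd).commutatorElement_right (hS.triple₂ (by omega) ha hb hd)
  have hed' : Commute ⁅c * ⁅a, b⁆ * c⁻¹, d⁆ d := by
    rw [conjugate_commutatorElement]; exact hS.triple₃ (by omega) hca hcb hd
  have hede' : Commute ⁅c * ⁅a, b⁆ * c⁻¹, d⁆ (c * ⁅a, b⁆ * c⁻¹) := by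
    rw [conjugate_commutatorElement]
    exact (hS.triple₁ (by omega) hca hcb hd).commutatorElement_right
      (hS.triple₂ (by omega) hca hcb hd)
  -- The commutator `⁅d, c⁆` enters through `c⁻¹ * d * c = ⁅d, c⁆ * d`.
  have hcn : Commute ⁅⁅a, b⁆, ⁅d, c⁆⁆ c :=
    (hS.commute_two_pairs₂ (by omega) ha hb hd hc).commutatorElement_swap_left
  have hdn : Commute ⁅⁅a, b⁆, ⁅d, c⁆⁆ d :=
    (hS.commute_two_pairs₁ (by omega) ha hb hd hc).commutatorElement_swap_left
  have hen : Commute ⁅⁅a, b⁆, ⁅d, c⁆⁆ ⁅a, b⁆ :=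
    (hS.commute_two_pairs₃ (by omega) ha hb hd hc).commutatorElement_swap_left
  have hned : Commute ⁅d, c⁆ ⁅⁅a, b⁆, d⁆ :=
    (hS.commute_commutator_commutator (by omega) ha hb hd hc).commutatorElement_swap
  have hexp : ⁅c * ⁅a, b⁆ * c⁻¹, d⁆ = ⁅⁅a, b⁆, ⁅d, c⁆⁆ * (⁅c, ⁅⁅a, b⁆, d⁆⁆ * ⁅⁅a, b⁆, d⁆) := by
    have h1 : ⁅c * ⁅a, b⁆ * c⁻¹, d⁆ = c * ⁅⁅a, b⁆, c⁻¹ * d * c⁆ * c⁻¹ := by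
      simp only [commutatorElement_def]; group
    rw [h1, inv_conj_eq (hS.pair (by omega) hd hc), commutator_mul_right, hned.conj_eq,
      ← conj_eq_commutator_mul, ← conj_mul, hcn.symm.conj_eq]
  have hkey : Commute ⁅c * ⁅a, b⁆ * c⁻¹, d⁆ ⁅⁅a, b⁆, d⁆ := by
    rw [hexp]
    exact (hen.commutatorElement_right hdn).mul_left
      ((((hS.triple_commutator_left₁ (by omega) ha hb hd
        hc).commutatorElement_swap_left).commutatorElement_right
        ((hS.triple_commutator_left₂ (by omega) ha hb hd hc).commutatorElement_swap_left)).mul_left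
        (Commute.refl _))
  -- Conjugating by `⁅a, b⁆⁻¹`, where `⁅a, b⁆⁻¹ * d * ⁅a, b⁆ = ⁅d, ⁅a, b⁆⁆ * d`.
  have h2 : Commute (⁅a, b⁆ * ⁅c * ⁅a, b⁆ * c⁻¹, d⁆ * ⁅a, b⁆⁻¹) d := by
    have h3 : Commute ⁅c * ⁅a, b⁆ * c⁻¹, d⁆ (⁅a, b⁆⁻¹ * d * ⁅a, b⁆) := by
      rw [inv_conj_eq hede.commutatorElement_swap_left]
      exact hkey.commutatorElement_swap.mul_right hed'
    have h4 := (Commute.conj_iff ⁅a, b⁆).2 h3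
    have e : ⁅a, b⁆ * (⁅a, b⁆⁻¹ * d * ⁅a, b⁆) * ⁅a, b⁆⁻¹ = d := by group
    rwa [e] at h4
  have h5 : ⁅⁅a, b⁆, c⁆ = ⁅a, b⁆ * (c * ⁅a, b⁆ * c⁻¹)⁻¹ := by
    rw [commutatorElement_def ⁅a, b⁆ c]; group
  have h6 : ⁅a, b⁆ * ⁅c * ⁅a, b⁆ * c⁻¹, d⁆⁻¹ * ⁅a, b⁆⁻¹ =
    (⁅a, b⁆ * ⁅c * ⁅a, b⁆ * c⁻¹, d⁆ * ⁅a, b⁆⁻¹)⁻¹ := by group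
  rw [h5, commutator_mul_left, commutator_inv_left_of_commute hede', h6]
  exact h2.inv_left.mul_left hed

theorem triple_commutator_middle : ⁅⁅c, ⁅a, b⁆⁆, d⁆ = ⁅⁅⁅a, b⁆, c⁆, d⁆⁻¹ := by
  rw [← commutatorElement_inv ⁅a, b⁆ c, commutator_inv_left_of_commute]
  exact (hS.triple_commutator_left₁ h ha hb hc hd).commutatorElement_right
    (hS.triple_commutator_left₂ h ha hb hc hd)

end

end SandwichUpTo
end Family

/-! ### The sandwich system generated by a strong sandwich set -/

section Nilpotent
variable {G : Type*} [Group G]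

/-- `Gen X n a`: the element `a` is an iterated commutator of conjugates of elements of `X`,
formed with `n` commutator brackets. -/
inductive Gen (X : Set G) : ℕ → G → Prop
  | base (g : G) {x : G} (hx : x ∈ X) : Gen X 0 (g * x * g⁻¹)
  | comm {m n : ℕ} {a b : G} (ha : Gen X m a) (hb : Gen X n b) : Gen X (m + n + 1) ⁅a, b⁆

theorem Gen.conj {X : Set G} {n : ℕ} {a : G} (ha : Gen X n a) (g : G) :
    Gen X n (g * a * g⁻¹) := by
  induction ha with
  | base f hx =>
    rename_i x
    have h : g * (f * x * f⁻¹) * g⁻¹ = (g * f) * x * (g * f)⁻¹ := by group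
    rw [h]; exact .base _ hx
  | comm _ _ iha ihb => rw [conjugate_commutatorElement]; exact .comm iha ihb

theorem Gen.exists_of_zero {X : Set G} {n : ℕ} {a : G} (ha : Gen X n a) (hn : n = 0) :
    ∃ g, ∃ x ∈ X, a = g * x * g⁻¹ := by
  cases ha with
  | base g hx => exact ⟨g, _, hx, rfl⟩
  | comm _ _ => omega

theorem Gen.exists_of_pos {X : Set G} {n : ℕ} {a : G} (ha : Gen X n a) (hn : 0 < n) :
    ∃ i j b c, Gen X i b ∧ Gen X j c ∧ i + j + 1 = n ∧ a = ⁅b, c⁆ := by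
  cases ha with
  | base g hx => omega
  | comm hb hc => exact ⟨_, _, _, _, hb, hc, rfl, rfl⟩

theorem commute_of_class_two {H : Subgroup G} (h : NilpotentOfClassAtMost H 2) {x y z : G}
    (hx : x ∈ H) (hy : y ∈ H) (hz : z ∈ H) : Commute ⁅x, y⁆ z := by
  have := h.1
  have h1 : ⁅⁅x, y⁆, z⁆ ∈ H.lowerCentralSeries 2 :=
    Subgroup.commutator_mem_commutator (Subgroup.commutator_mem_commutator hx hy) hz
  rw [Subgroup.lowerCentralSeries_eq_bot_of_nilpotencyClass_le h.2, Subgroup.mem_bot] at h1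
  exact commutatorElement_eq_one_iff_commute.1 h1

theorem commute_of_class_three {H : Subgroup G} (h : NilpotentOfClassAtMost H 3) {x y z w : G}
    (hx : x ∈ H) (hy : y ∈ H) (hz : z ∈ H) (hw : w ∈ H) : Commute ⁅⁅x, y⁆, z⁆ w := by
  have := h.1
  have h1 : ⁅⁅⁅x, y⁆, z⁆, w⁆ ∈ H.lowerCentralSeries 3 :=
    Subgroup.commutator_mem_commutator (Subgroup.commutator_mem_commutator
      (Subgroup.commutator_mem_commutator hx hy) hz) hw
  rw [Subgroup.lowerCentralSeries_eq_bot_of_nilpotencyClass_le h.2, Subgroup.mem_bot] at h1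
  exact commutatorElement_eq_one_iff_commute.1 h1

theorem sandwichUpTo_zero {X : Set G} (hX : IsStrongSandwichSet X)
    (hgen : Subgroup.closure X = ⊤) : SandwichUpTo (fun n => {a | Gen X n a}) 0 := by
  have hmem : ∀ g : G, g ∈ Subgroup.closure X := fun g => hgen ▸ Subgroup.mem_top g
  have two : ∀ {a b : G}, Gen X 0 a → Gen X 0 b → Commute ⁅a, b⁆ b := by
    intro a b ha hb
    obtain ⟨g, x, hx, rfl⟩ := ha.exists_of_zero rfl
    obtain ⟨f, y, hy, h⟩ := (hb.conj g⁻¹).exists_of_zero rfl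
    rw [← Commute.conj_iff g⁻¹, conjugate_commutatorElement, h]
    have hs := hX.two x hx y hy f⁻¹ (hmem _)
    rw [inv_inv] at hs
    have e : g⁻¹ * (g * x * g⁻¹) * g⁻¹⁻¹ = x := by group
    rw [e]
    exact commute_of_class_two hs (Subgroup.subset_closure (by simp))
      (Subgroup.subset_closure (by simp)) (Subgroup.subset_closure (by simp))
  have three : ∀ {a b c : G}, Gen X 0 a → Gen X 0 b → Gen X 0 c → ∀ w ∈ ({a, b, c} : Set G),
      Commute ⁅⁅a, b⁆, c⁆ w := by
    intro a b c ha hb hc w hw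
    obtain ⟨g, x, hx, rfl⟩ := ha.exists_of_zero rfl
    obtain ⟨f, y, hy, h⟩ := (hb.conj g⁻¹).exists_of_zero rfl
    obtain ⟨f', z, hz, h'⟩ := (hc.conj g⁻¹).exists_of_zero rfl
    have e : g⁻¹ * (g * x * g⁻¹) * g⁻¹⁻¹ = x := by group
    have hs := hX.three x hx y hy z hz f⁻¹ (hmem _) f'⁻¹ (hmem _)
    rw [inv_inv, inv_inv] at hs
    rw [← Commute.conj_iff g⁻¹, conjugate_commutatorElement, conjugate_commutatorElement, h, h', e]
    refine commute_of_class_three hs (Subgroup.subset_closure (by simp))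
      (Subgroup.subset_closure (by simp)) (Subgroup.subset_closure (by simp))
      (Subgroup.subset_closure ?_)
    rcases hw with rfl | rfl | rfl
    · rw [e]; simp
    · rw [h]; simp
    · rw [h']; simp
  refine ⟨fun g ha => Gen.conj ha g, ?_, ?_, ?_, ?_⟩
  · intro i j a b h ha hb
    obtain ⟨rfl, rfl⟩ : i = 0 ∧ j = 0 := by omega
    exact two ha hb
  all_goals
    intro i j k a b c h ha hb hc
    obtain ⟨rfl, rfl, rfl⟩ : i = 0 ∧ j = 0 ∧ k = 0 := by omega
    exact three ha hb hc _ (by simp)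

/-- In a pair or triple of total size `N + 1` some entry is a commutator `⁅p, q⁆`; replacing that
entry by `p` and `q` leaves relations of total size `N`. -/
theorem SandwichUpTo.succ {X : Set G} {N : ℕ} (hS : SandwichUpTo (fun n => {a | Gen X n a}) N) :
    SandwichUpTo (fun n => {a | Gen X n a}) (N + 1) := by
  have two : ∀ {i j : ℕ} {a b : G}, i + j = N + 1 → Gen X i a → Gen X j b → Commute ⁅a, b⁆ b := by
    intro i j a b h ha hb
    rcases Nat.eq_zero_or_pos i with hi | hi
    · obtain ⟨m, n, p, q, hp, hq, hn, rfl⟩ := hb.exists_of_pos (by omega)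
      exact ((hS.triple₁ (by omega) hp hq ha).commutatorElement_right
        (hS.triple₂ (by omega) hp hq ha)).commutatorElement_swap_left
    · obtain ⟨m, n, p, q, hp, hq, hn, rfl⟩ := ha.exists_of_pos hi
      exact hS.triple₃ (by omega) hp hq hb
  have three : ∀ {i j k : ℕ} {a b c : G}, i + j + k = N + 1 → Gen X i a → Gen X j b → Gen X k c →
      Commute ⁅⁅a, b⁆, c⁆ a ∧ Commute ⁅⁅a, b⁆, c⁆ b ∧ Commute ⁅⁅a, b⁆, c⁆ c := by
    intro i j k a b c h ha hb hc
    rcases Nat.eq_zero_or_pos i with hi | hi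
    · rcases Nat.eq_zero_or_pos j with hj | hj
      · obtain ⟨m, n, p, q, hp, hq, hn, rfl⟩ := hc.exists_of_pos (by omega)
        exact ⟨hS.commute_two_pairs₁ (by omega) hp hq ha hb,
          hS.commute_two_pairs₂ (by omega) hp hq ha hb,
          hS.commute_two_pairs₃ (by omega) hp hq ha hb⟩
      · obtain ⟨m, n, p, q, hp, hq, hn, rfl⟩ := hb.exists_of_pos hj
        rw [hS.triple_commutator_middle (N := N) (by omega) hp hq ha hc]
        exact ⟨(hS.triple_commutator_left₂ (by omega) hp hq ha hc).inv_left,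
          (hS.triple_commutator_left₁ (by omega) hp hq ha hc).inv_left,
          (hS.triple_commutator_left₃ (by omega) hp hq ha hc).inv_left⟩
    · obtain ⟨m, n, p, q, hp, hq, hn, rfl⟩ := ha.exists_of_pos hi
      exact ⟨hS.triple_commutator_left₁ (by omega) hp hq hb hc,
        hS.triple_commutator_left₂ (by omega) hp hq hb hc,
        hS.triple_commutator_left₃ (by omega) hp hq hb hc⟩
  refine ⟨hS.conj, ?_, ?_, ?_, ?_⟩
  · intro i j a b h ha hb
    rcases Nat.lt_or_ge N (i + j) with h' | h'
    · exact two (by omega) ha hb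
    · exact hS.pair h' ha hb
  · intro i j k a b c h ha hb hc
    rcases Nat.lt_or_ge N (i + j + k) with h' | h'
    · exact (three (by omega) ha hb hc).1
    · exact hS.triple₁ h' ha hb hc
  · intro i j k a b c h ha hb hc
    rcases Nat.lt_or_ge N (i + j + k) with h' | h'
    · exact (three (by omega) ha hb hc).2.1
    · exact hS.triple₂ h' ha hb hc
  · intro i j k a b c h ha hb hc
    rcases Nat.lt_or_ge N (i + j + k) with h' | h'
    · exact (three (by omega) ha hb hc).2.2
    · exact hS.triple₃ h' ha hb hc

theorem sandwichUpTo_gen {X : Set G} (hX : IsStrongSandwichSet X)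
    (hgen : Subgroup.closure X = ⊤) (N : ℕ) : SandwichUpTo (fun n => {a | Gen X n a}) N := by
  induction N with
  | zero => exact sandwichUpTo_zero hX hgen
  | succ N ih => exact ih.succ

/-- A set closed under commutators whose elements satisfy the consequences of the sandwich
relations used in the termination argument; the notion passes to homomorphic images. -/
structure IsSandwichSystem (C : Set G) : Prop where
  comm_mem : ∀ {a b : G}, a ∈ C → b ∈ C → ⁅a, b⁆ ∈ C
  pair : ∀ {a b : G}, a ∈ C → b ∈ C → Commute ⁅a, b⁆ b
  common_right : ∀ {a b c : G}, a ∈ C → b ∈ C → c ∈ C → Commute ⁅a, c⁆ ⁅b, c⁆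
  triple : ∀ {a b c : G}, a ∈ C → b ∈ C → c ∈ C → Commute ⁅c, ⁅a, b⁆⁆ a
  jacobi : ∀ {a b c : G}, a ∈ C → b ∈ C → c ∈ C → ⁅c, ⁅a, b⁆⁆ = ⁅⁅b, c⁆, a⁆ * ⁅⁅c, a⁆, b⁆

theorem isSandwichSystem_gen {X : Set G} (hX : IsStrongSandwichSet X)
    (hgen : Subgroup.closure X = ⊤) : IsSandwichSystem {a | ∃ n, Gen X n a} where
  comm_mem := fun ⟨_, ha⟩ ⟨_, hb⟩ => ⟨_, .comm ha hb⟩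
  pair := fun ⟨_, ha⟩ ⟨_, hb⟩ => (sandwichUpTo_gen hX hgen _).pair le_rfl ha hb
  common_right := fun ⟨_, ha⟩ ⟨_, hb⟩ ⟨_, hc⟩ =>
    (sandwichUpTo_gen hX hgen _).commute_right le_rfl ha hb hc
  triple := fun ⟨_, ha⟩ ⟨_, hb⟩ ⟨_, hc⟩ =>
    ((sandwichUpTo_gen hX hgen _).triple₁ le_rfl ha hb hc).commutatorElement_swap_left
  jacobi := fun ⟨_, ha⟩ ⟨_, hb⟩ ⟨_, hc⟩ => (sandwichUpTo_gen hX hgen _).jacobi le_rfl ha hb hc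

theorem IsSandwichSystem.map {C : Set G} (hC : IsSandwichSystem C) {G' : Type*} [Group G']
    (f : G →* G') : IsSandwichSystem (f '' C) where
  comm_mem := by
    rintro _ _ ⟨a, ha, rfl⟩ ⟨b, hb, rfl⟩
    exact ⟨_, hC.comm_mem ha hb, map_commutatorElement f a b⟩
  pair := by
    rintro _ _ ⟨a, ha, rfl⟩ ⟨b, hb, rfl⟩
    simpa only [map_commutatorElement] using (hC.pair ha hb).map f
  common_right := by
    rintro _ _ _ ⟨a, ha, rfl⟩ ⟨b, hb, rfl⟩ ⟨c, hc, rfl⟩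
    simpa only [map_commutatorElement] using (hC.common_right ha hb hc).map f
  triple := by
    rintro _ _ _ ⟨a, ha, rfl⟩ ⟨b, hb, rfl⟩ ⟨c, hc, rfl⟩
    simpa only [map_commutatorElement] using (hC.triple ha hb hc).map f
  jacobi := by
    rintro _ _ _ ⟨a, ha, rfl⟩ ⟨b, hb, rfl⟩ ⟨c, hc, rfl⟩
    simpa only [map_commutatorElement, map_mul] using congrArg f (hC.jacobi ha hb hc)

theorem IsSandwichSystem.commutator_assoc_of_commute {C : Set G} (hC : IsSandwichSystem C)
    {a b c : G} (ha : a ∈ C) (hb : b ∈ C) (hc : c ∈ C) (h : Commute c b) :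
    ⁅⁅c, a⁆, b⁆ = ⁅c, ⁅a, b⁆⁆ := by
  rw [hC.jacobi ha hb hc, commutatorElement_eq_one_iff_commute.2 h.symm,
    commutatorElement_one_left, one_mul]

end Nilpotent

/-! ### Greedy runs terminate -/

section Runs
variable {G : Type*} [Group G]

open Classical in
/-- The greedy step: `step X b` is `⁅b, x⁆` for the first `x` in the list `X` which does not
commute with `b`, and `1` if there is no such `x`. -/
noncomputable def step : List G → G → G
  | [], _ => 1
  | x :: X, b => if ⁅b, x⁆ = 1 then step X b else ⁅b, x⁆

theorem step_eq_one {X : List G} {b : G} (h : ∀ x ∈ X, Commute b x) : step X b = 1 := by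
  induction X with
  | nil => rfl
  | cons x X ih =>
    rw [step, if_pos (commutatorElement_eq_one_iff_commute.2 (h x (by simp)))]
    exact ih fun y hy => h y (by simp [hy])

theorem step_append_of_commute {X : List G} {b : G} (h : ∀ x ∈ X, Commute b x) (Y : List G) :
    step (X ++ Y) b = step Y b := by
  induction X with
  | nil => rfl
  | cons x X ih =>
    rw [List.cons_append, step, if_pos (commutatorElement_eq_one_iff_commute.2 (h x (by simp)))]
    exact ih fun y hy => h y (by simp [hy])

theorem step_append_of_not_commute {X : List G} {b : G} (h : ¬ ∀ x ∈ X, Commute b x)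
    (Y : List G) : step (X ++ Y) b = step X b := by
  induction X with
  | nil => simp at h
  | cons x X ih =>
    by_cases hx : ⁅b, x⁆ = 1
    · rw [List.cons_append, step, step, if_pos hx, if_pos hx]
      refine ih fun h' => h ?_
      intro y hy
      rcases List.mem_cons.1 hy with rfl | hy
      · exact commutatorElement_eq_one_iff_commute.1 hx
      · exact h' y hy
    · rw [List.cons_append, step, step, if_neg hx, if_neg hx]

theorem step_cons_of_not_commute {x b : G} (h : ¬ Commute b x) (X : List G) :
    step (x :: X) b = ⁅b, x⁆ := by
  rw [step, if_neg (mt commutatorElement_eq_one_iff_commute.1 h)]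

theorem step_ne_one {X : List G} {b : G} (h : ¬ ∀ x ∈ X, Commute b x) : step X b ≠ 1 := by
  induction X with
  | nil => simp at h
  | cons x X ih =>
    by_cases hx : ⁅b, x⁆ = 1
    · rw [step, if_pos hx]
      refine ih fun h' => h ?_
      intro y hy
      rcases List.mem_cons.1 hy with rfl | hy
      · exact commutatorElement_eq_one_iff_commute.1 hx
      · exact h' y hy
    · rwa [step, if_neg hx]

theorem step_iterate_one (X : List G) (n : ℕ) : (step X)^[n] 1 = 1 :=
  Function.iterate_fixed (step_eq_one fun x _ => Commute.one_left x) n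

theorem step_iterate_ne_one_of_succ {X : List G} {n : ℕ} {b : G} (h : (step X)^[n + 1] b ≠ 1) :
    (step X)^[n] b ≠ 1 := by
  intro h'
  rw [Function.iterate_succ_apply', h'] at h
  exact h (step_iterate_one X 1)

variable {C : Set G}

theorem IsSandwichSystem.step_mem (hC : IsSandwichSystem C) {X : List G} (hX : ∀ x ∈ X, x ∈ C)
    {b : G} (hb : b ∈ C) : step X b ∈ C := by
  induction X with
  | nil => rw [step, ← commutatorElement_self b]; exact hC.comm_mem hb hb
  | cons x X ih =>
    rw [step]
    split_ifs
    · exact ih fun y hy => hX y (by simp [hy])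
    · exact hC.comm_mem hb (hX x (by simp))

/-- Greedy runs over `X` starting in `C` can stay away from `1` for arbitrarily many steps. -/
def Long (C : Set G) (X : List G) : Prop :=
  ∀ n, ∃ b ∈ C, (step X)^[n] b ≠ 1

theorem not_long_nil : ¬ Long C ([] : List G) := fun h => by
  obtain ⟨b, -, hb⟩ := h 1
  exact hb rfl

theorem exists_minimal_long {Y Z : List G} (hY : ¬ Long C Y) (hZ : Long C (Y ++ Z)) :
    ∃ Z₁ v Z₂, Z = Z₁ ++ v :: Z₂ ∧ ¬ Long C (Y ++ Z₁) ∧ Long C ((Y ++ Z₁) ++ [v]) := by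
  induction Z generalizing Y with
  | nil => rw [List.append_nil] at hZ; exact absurd hZ hY
  | cons z Z ih =>
    by_cases h : Long C (Y ++ [z])
    · exact ⟨[], z, Z, rfl, by rwa [List.append_nil], by rwa [List.append_nil]⟩
    · obtain ⟨Z₁, v, Z₂, rfl, h1, h2⟩ := ih h (by simpa using hZ)
      exact ⟨z :: Z₁, v, Z₂, rfl, by simpa using h1, by simpa using h2⟩

theorem IsSandwichSystem.step_map (hC : IsSandwichSystem C) {p b : G} (hp : p ∈ C) (hb : b ∈ C)
    {Y : List G} (hY : ∀ y ∈ Y, y ∈ C) (h : ∀ y ∈ Y, Commute b y) :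
    step (Y.map fun z => ⁅p, z⁆) b = step Y ⁅b, p⁆ := by
  induction Y with
  | nil => rfl
  | cons y Y ih =>
    rw [List.map_cons, step, step,
      hC.commutator_assoc_of_commute hp (hY y (by simp)) hb (h y (by simp)),
      ih (fun z hz => hY z (by simp [hz])) fun z hz => h z (by simp [hz])]

/-- If the letter `p` is used in a run over `Y ++ [p]`, then the current element `b` commutes with
`Y`, and the next letter `z` must come from `Y`, since `⁅b, p⁆` commutes with `p`. The two steps
result in `⁅⁅b, p⁆, z⁆ = ⁅b, ⁅p, z⁆⁆`, a single step with the letter `⁅p, z⁆`. -/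
theorem IsSandwichSystem.iterate_recode (hC : IsSandwichSystem C) {p : G} (hp : p ∈ C) {Y : List G}
    (hY : ∀ y ∈ Y, y ∈ C) (n : ℕ) {b : G} (hb : b ∈ C)
    (h : (step (Y ++ [p]))^[2 * n] b ≠ 1) :
    (step (Y ++ Y.map fun z => ⁅p, z⁆))^[n] b ≠ 1 := by
  induction n generalizing b with
  | zero => exact h
  | succ n ih =>
    rw [Function.iterate_succ_apply]
    by_cases hbY : ∀ y ∈ Y, Commute b y
    · rw [step_append_of_commute hbY, hC.step_map hp hb hY hbY]
      have hbp : step (Y ++ [p]) b = ⁅b, p⁆ := by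
        rw [step_append_of_commute hbY]
        by_cases h1 : ⁅b, p⁆ = 1
        · rw [step, if_pos h1, h1]; rfl
        · rw [step, if_neg h1]
      rw [show 2 * (n + 1) = 2 * n + 1 + 1 by ring, Function.iterate_succ_apply,
        Function.iterate_succ_apply, hbp] at h
      have h2 : step (Y ++ [p]) ⁅b, p⁆ = step Y ⁅b, p⁆ := by
        by_cases h3 : ∀ y ∈ Y, Commute ⁅b, p⁆ y
        · rw [step_append_of_commute h3, step_eq_one h3]
          exact step_eq_one (by simpa using hC.pair hb hp)
        · exact step_append_of_not_commute h3 _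
      rw [h2] at h
      exact ih (hC.step_mem hY (hC.comm_mem hb hp)) h
    · rw [step_append_of_not_commute hbY]
      refine ih (hC.step_mem hY hb) ?_
      rw [show 2 * (n + 1) = 2 * n + 1 + 1 by ring, Function.iterate_succ_apply,
        step_append_of_not_commute hbY] at h
      exact step_iterate_ne_one_of_succ h

/-- A list `Y` with a further letter `p` such that greedy runs over `Y` have bounded length while
those over `Y ++ [p]` do not. -/
structure IsState (C : Set G) (Y : List G) (p : G) : Prop where
  mem : ∀ y ∈ Y, y ∈ C
  mem_last : p ∈ C
  long : Long C (Y ++ [p])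
  not_long : ¬ Long C Y

/-- The elements at which a greedy run over `Y ++ [p]` uses the letter `p`. -/
def witnesses (C : Set G) (Y : List G) (p : G) : Set G :=
  {c | c ∈ C ∧ (∀ y ∈ Y, Commute c y) ∧ ¬ Commute c p}

/-- The letters of `Y` that can produce, in one commutator, an element where `p` is used next. -/
def sources (C : Set G) (Y : List G) (p : G) : Set G :=
  {q | q ∈ Y ∧ ∃ b ∈ C, ⁅b, q⁆ ∈ witnesses C Y p}

theorem IsState.witnesses_nonempty (hC : IsSandwichSystem C) {Y : List G} {p : G}
    (h : IsState C Y p) : (witnesses C Y p).Nonempty := by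
  by_contra hT
  have hstep : ∀ c ∈ C, step (Y ++ [p]) c = step Y c := by
    intro c hc
    by_cases hY : ∀ y ∈ Y, Commute c y
    · have hp : Commute c p := by
        by_contra hp
        exact hT ⟨c, hc, hY, hp⟩
      rw [step_append_of_commute hY, step_eq_one hY, step_eq_one (by simpa using hp)]
    · exact step_append_of_not_commute hY _
  have hiter : ∀ (n : ℕ), ∀ c ∈ C, (step (Y ++ [p]))^[n] c = (step Y)^[n] c := by
    intro n
    induction n with
    | zero => intro c _; rfl
    | succ n ih =>
      intro c hc
      rw [Function.iterate_succ_apply, Function.iterate_succ_apply, hstep c hc]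
      exact ih _ (hC.step_mem h.mem hc)
  refine h.not_long fun n => ?_
  obtain ⟨b, hb, hbn⟩ := h.long n
  exact ⟨b, hb, by rwa [← hiter n b hb]⟩

/-- Every state `(Y, p)` yields another one, `(Y ++ Y₁.map ⁅p, ·⁆, ⁅p, v⁆)` with `Y₁ ++ [v]` an
initial segment of `Y`: append the letters `⁅p, z⁆`, `z ∈ Y`, one by one until runs become
unbounded. -/
theorem IsState.exists_derived (hC : IsSandwichSystem C) {Y : List G} {p : G}
    (h : IsState C Y p) : ∃ Y₁ v Y₂, Y = Y₁ ++ v :: Y₂ ∧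
      IsState C (Y ++ Y₁.map fun z => ⁅p, z⁆) ⁅p, v⁆ := by
  have hlong : Long C (Y ++ Y.map fun z => ⁅p, z⁆) := fun n => by
    obtain ⟨b, hb, hbn⟩ := h.long (2 * n)
    exact ⟨b, hb, hC.iterate_recode h.mem_last h.mem n hb hbn⟩
  obtain ⟨Z₁, w, Z₂, hZ, h1, h2⟩ := exists_minimal_long h.not_long hlong
  obtain ⟨Y₁, Y', rfl, rfl, h3⟩ := List.map_eq_append_iff.1 hZ
  obtain ⟨v, Y₂, rfl, rfl, rfl⟩ := List.map_eq_cons_iff.1 h3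
  refine ⟨Y₁, v, Y₂, rfl, ⟨?_, hC.comm_mem h.mem_last (h.mem v (by simp)), h2, h1⟩⟩
  intro y hy
  rcases List.mem_append.1 hy with hy | hy
  · exact h.mem y hy
  · obtain ⟨z, hz, rfl⟩ := List.mem_map.1 hy
    exact hC.comm_mem h.mem_last (h.mem z (by simp [hz]))

theorem witnesses_derived_subset {Y₁ Y₂ : List G} {v p : G} :
    witnesses C ((Y₁ ++ v :: Y₂) ++ Y₁.map fun z => ⁅p, z⁆) ⁅p, v⁆ ⊆
      witnesses C (Y₁ ++ v :: Y₂) p := by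
  rintro c ⟨hc, hY, hp⟩
  exact ⟨hc, fun y hy => hY y (List.mem_append_left _ hy), fun h =>
    hp (h.commutatorElement_right (hY v (by simp)))⟩

/-- In the derived state `v` is no source, and no letter has become one: `⁅b, v⁆` commutes with
`⁅p, v⁆`, and `⁅b, ⁅p, z⁆⁆` commutes with `p`. -/
theorem IsSandwichSystem.sources_derived_subset (hC : IsSandwichSystem C) {Y₁ Y₂ : List G}
    {v p : G} (hY : ∀ y ∈ Y₁ ++ v :: Y₂, y ∈ C) (hp : p ∈ C) :
    sources C ((Y₁ ++ v :: Y₂) ++ Y₁.map fun z => ⁅p, z⁆) ⁅p, v⁆ ⊆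
      sources C (Y₁ ++ v :: Y₂) p \ {v} := by
  rintro q ⟨hq, b, hb, hT⟩
  rcases List.mem_append.1 hq with hq | hq
  · refine ⟨⟨hq, b, hb, witnesses_derived_subset hT⟩, ?_⟩
    rintro rfl
    exact hT.2.2 (hC.common_right hb hp (hY q hq))
  · obtain ⟨z, hz, rfl⟩ := List.mem_map.1 hq
    exact absurd (hC.triple hp (hY z (by simp [hz])) hb) (witnesses_derived_subset hT).2.2

theorem finite_sources (C : Set G) (Y : List G) (p : G) : (sources C Y p).Finite :=
  (List.finite_toSet Y).subset fun _ h => h.1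

/-- In a state with a minimal set of sources, every derivation keeps this set, so the letter `v`
of the derivation is never a source. Hence for `c` a witness of the `k`-th derived state `(Y, p)`,
the element `⁅c, p⁆` is the result of `k` greedy steps over the *original* list `Y₀` from
`⁅c, p₀⁆`. As every state has a witness, runs over `Y₀` are unbounded, a contradiction. -/
theorem IsSandwichSystem.not_isState_of_minimal (hC : IsSandwichSystem C) {Y₀ : List G} {p₀ : G}
    (h₀ : IsState C Y₀ p₀)
    (hmin : ∀ Y p, IsState C Y p → sources C Y p ⊆ sources C Y₀ p₀ →
      sources C Y p = sources C Y₀ p₀) : False := by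
  have claim : ∀ k : ℕ, ∃ Z p, IsState C (Y₀ ++ Z) p ∧
      (∀ y ∈ Y₀ ++ Z, y ∈ Subgroup.closure ({y | y ∈ Y₀} ∪ {p₀})) ∧
      p ∈ Subgroup.closure ({y | y ∈ Y₀} ∪ {p₀}) ∧
      sources C (Y₀ ++ Z) p ⊆ sources C Y₀ p₀ ∧
      witnesses C (Y₀ ++ Z) p ⊆ witnesses C Y₀ p₀ ∧
      ∀ c ∈ witnesses C (Y₀ ++ Z) p, ⁅c, p⁆ = (step Y₀)^[k] ⁅c, p₀⁆ ∧
        ((∀ y ∈ Y₀, Commute ⁅c, p⁆ y) → Commute ⁅c, p⁆ p₀) := by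
    intro k
    induction k with
    | zero =>
      refine ⟨[], p₀, by rwa [List.append_nil], ?_,
        Subgroup.subset_closure (Or.inr rfl), ?_, ?_, ?_⟩
      · intro y hy
        exact Subgroup.subset_closure (Or.inl (by simpa using hy))
      · rw [List.append_nil]
      · rw [List.append_nil]
      · intro c hc
        exact ⟨rfl, fun _ => hC.pair hc.1 h₀.mem_last⟩
    | succ k ih =>
      obtain ⟨Z, p, hs, hK, hpK, hQ, hT, hc⟩ := ih
      obtain ⟨Y₁, v, Y₂, hY, hs'⟩ := hs.exists_derived hC
      have hvY : v ∈ Y₀ ++ Z := by rw [hY]; simp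
      have hsub : ∀ z ∈ Y₁, z ∈ Y₀ ++ Z := fun z hz => by rw [hY]; simp [hz]
      have hQ' := hC.sources_derived_subset (hY ▸ hs.mem) hs.mem_last
      have hT' := witnesses_derived_subset (C := C) (Y₁ := Y₁) (Y₂ := Y₂) (v := v) (p := p)
      rw [← hY] at hQ' hT'
      have hQ₀ : sources C (Y₀ ++ Z ++ Y₁.map fun z => ⁅p, z⁆) ⁅p, v⁆ ⊆ sources C Y₀ p₀ :=
        fun q hq => hQ (hQ' hq).1
      have hv : v ∉ sources C Y₀ p₀ := by
        rw [← hmin _ _ hs' hQ₀]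
        exact fun h => (hQ' h).2 rfl
      refine ⟨Z ++ Y₁.map fun z => ⁅p, z⁆, ⁅p, v⁆, ?_⟩
      rw [← List.append_assoc]
      have comm_memK : ∀ z ∈ Y₀ ++ Z, ⁅p, z⁆ ∈ Subgroup.closure ({y | y ∈ Y₀} ∪ {p₀}) :=
        fun z hz => by
          rw [commutatorElement_def]
          exact mul_mem (mul_mem (mul_mem hpK (hK z hz)) (inv_mem hpK)) (inv_mem (hK z hz))
      refine ⟨hs', ?_, comm_memK v hvY, hQ₀, hT'.trans hT, ?_⟩
      · intro y hy
        rcases List.mem_append.1 hy with hy | hy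
        · exact hK y hy
        · obtain ⟨z, hz, rfl⟩ := List.mem_map.1 hy
          exact comm_memK z (hsub z hz)
      · intro c hcT
        obtain ⟨hck, hck₀⟩ := hc c (hT' hcT)
        have hcC : ⁅c, p⁆ ∈ C := hC.comm_mem hcT.1 hs.mem_last
        have hcY : ∀ z ∈ Y₀ ++ Z, ⁅⁅c, p⁆, z⁆ = ⁅c, ⁅p, z⁆⁆ := fun z hz =>
          hC.commutator_assoc_of_commute hs.mem_last (hs.mem z hz) hcT.1
            (hcT.2.1 z (List.mem_append_left _ hz))
        have hY₁ : ∀ z ∈ Y₁, Commute ⁅c, p⁆ z := fun z hz => by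
          rw [← commutatorElement_eq_one_iff_commute, hcY z (hsub z hz),
            commutatorElement_eq_one_iff_commute]
          exact hcT.2.1 _ (List.mem_append_right _ (List.mem_map.2 ⟨z, hz, rfl⟩))
        have hcv : ¬ Commute ⁅c, p⁆ v := by
          rw [← commutatorElement_eq_one_iff_commute, hcY v hvY,
            commutatorElement_eq_one_iff_commute]
          exact hcT.2.2
        -- Otherwise `⁅c, p⁆` would centralise `Y₀` and `p₀`, hence the letter `v`, which lies in
        -- the subgroup they generate.
        have hnot : ¬ ∀ y ∈ Y₀, Commute ⁅c, p⁆ y := by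
          intro hall
          have hle : Subgroup.closure ({y | y ∈ Y₀} ∪ {p₀}) ≤ Subgroup.centralizer {⁅c, p⁆} := by
            rw [Subgroup.closure_le]
            rintro y (hy | rfl)
            · exact Subgroup.mem_centralizer_singleton_iff.2 (hall y hy).symm.eq
            · exact Subgroup.mem_centralizer_singleton_iff.2 (hck₀ hall).symm.eq
          exact hcv (Subgroup.mem_centralizer_singleton_iff.1 (hle (hK v hvY))).symm
        -- The first letter of `Y₀ ++ Z` not commuting with `⁅c, p⁆` is `v`, so it lies in `Y₀`.
        have hvY₀ : v ∈ Y₀ := by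
          rcases List.append_eq_append_iff.1 hY with ⟨A, hA, -⟩ | ⟨A, hA, hA'⟩
          · exact absurd (fun y hy => hY₁ y (by rw [hA]; simp [hy])) hnot
          · cases A with
            | nil =>
              rw [List.append_nil] at hA
              exact absurd (fun y hy => hY₁ y (hA ▸ hy)) hnot
            | cons w A =>
              obtain ⟨rfl, -⟩ := List.cons.inj hA'
              rw [hA]; simp
        have hstep : ⁅⁅c, p⁆, v⁆ = step Y₀ ⁅c, p⁆ := by
          rw [← step_append_of_not_commute hnot Z, hY, step_append_of_commute hY₁,
            step_cons_of_not_commute hcv]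
        rw [← hcY v hvY]
        refine ⟨by rw [hstep, hck, Function.iterate_succ_apply'], fun hall => ?_⟩
        -- Otherwise `⁅⁅c, p⁆, v⁆` would be a witness of the original state, and `v` a source.
        by_contra hp₀
        exact hv ⟨hvY₀, ⁅c, p⁆, hcC,
          hC.comm_mem hcC (hs.mem v hvY), hall, hp₀⟩
  refine h₀.not_long fun n => ?_
  obtain ⟨Z, p, hs, -, -, -, -, hc⟩ := claim n
  obtain ⟨c, hcT⟩ := hs.witnesses_nonempty hC
  refine ⟨⁅c, p₀⁆, hC.comm_mem hcT.1 h₀.mem_last, ?_⟩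
  rw [← (hc c hcT).1]
  exact mt commutatorElement_eq_one_iff_commute.1 hcT.2.2

theorem IsSandwichSystem.not_isState (hC : IsSandwichSystem C) {Y : List G} {p : G} :
    ¬ IsState C Y p := by
  induction hn : (sources C Y p).ncard using Nat.strong_induction_on generalizing Y p with
  | _ n ih =>
    intro h
    refine hC.not_isState_of_minimal h fun Y' p' h' hsub => ?_
    by_contra hne
    exact ih _ (hn ▸ Set.ncard_lt_ncard (hsub.ssubset_of_ne hne) (finite_sources C Y p)) rfl h'

theorem IsSandwichSystem.not_long (hC : IsSandwichSystem C) {X : List G}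
    (hX : ∀ x ∈ X, x ∈ C) : ¬ Long C X := by
  intro h
  obtain ⟨Y, p, Z, rfl, h1, h2⟩ := exists_minimal_long not_long_nil (Z := X) h
  exact hC.not_isState (Y := Y) (p := p) ⟨fun y hy => hX y (by simp [hy]), hX p (by simp), h2, h1⟩

end Runs

/-! ### The hypercenter and nilpotency -/

section Finish
variable {G : Type*} [Group G]

theorem exists_finset_of_mem_closure {X : Set G} {g : G} (hg : g ∈ Subgroup.closure X) :
    ∃ T : Finset G, (T : Set G) ⊆ X ∧ g ∈ Subgroup.closure (T : Set G) := by
  classical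
  induction hg using Subgroup.closure_induction with
  | mem x hx => exact ⟨{x}, by simpa using hx, Subgroup.subset_closure (by simp)⟩
  | one => exact ⟨∅, by simp, one_mem _⟩
  | mul x y _ _ hx hy =>
    obtain ⟨T, hT, hxT⟩ := hx
    obtain ⟨U, hU, hyU⟩ := hy
    refine ⟨T ∪ U, by simp [hT, hU], mul_mem (Subgroup.closure_mono ?_ hxT)
      (Subgroup.closure_mono ?_ hyU)⟩ <;> simp
  | inv x _ hx =>
    obtain ⟨T, hT, hxT⟩ := hx
    exact ⟨T, hT, inv_mem hxT⟩

theorem exists_finset_closure_eq_top (hfg : Group.FG G) {X : Set G}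
    (hX : Subgroup.closure X = ⊤) :
    ∃ T : Finset G, (T : Set G) ⊆ X ∧ Subgroup.closure (T : Set G) = ⊤ := by
  classical
  obtain ⟨S, hS, hfin⟩ := Group.fg_iff.1 hfg
  have h : ∀ g : G, ∃ T : Finset G, (T : Set G) ⊆ X ∧ g ∈ Subgroup.closure (T : Set G) :=
    fun g => exists_finset_of_mem_closure (hX ▸ Subgroup.mem_top g)
  choose T hTX hT using h
  refine ⟨hfin.toFinset.biUnion T, ?_, ?_⟩
  · intro x hx
    obtain ⟨g, -, hg⟩ := Finset.mem_biUnion.1 (Finset.mem_coe.1 hx)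
    exact hTX g hg
  · rw [eq_top_iff, ← hS, Subgroup.closure_le]
    intro g hg
    refine Subgroup.closure_mono (fun x hx => ?_) (hT g)
    exact Finset.mem_coe.2 (Finset.mem_biUnion.2 ⟨g, hfin.mem_toFinset.2 hg, hx⟩)

theorem mem_upperCentralSeries_succ_of_closure {X : Set G} (hX : Subgroup.closure X = ⊤) {n : ℕ}
    {g : G} (h : ∀ x ∈ X, ⁅g, x⁆ ∈ Subgroup.upperCentralSeries G n) :
    g ∈ Subgroup.upperCentralSeries G (n + 1) := by
  rw [Subgroup.mem_upperCentralSeries_succ_iff]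
  intro y
  have hn : (Subgroup.upperCentralSeries G n).Normal := inferInstance
  induction (hX ▸ Subgroup.mem_top y : y ∈ Subgroup.closure X) using
    Subgroup.closure_induction with
  | mem x hx => exact h x hx
  | one => rw [commutatorElement_one_right]; exact one_mem _
  | mul x y _ _ hx hy =>
    rw [commutator_mul_right]
    exact mul_mem hx (hn.conj_mem _ hy x)
  | inv x _ hx =>
    have e : ⁅g, x⁻¹⁆ = x⁻¹ * ⁅g, x⁆⁻¹ * x⁻¹⁻¹ := by simp only [commutatorElement_def]; group
    rw [e]
    exact hn.conj_mem _ (inv_mem hx) x⁻¹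

/-- The union of the finite terms of the upper central series. -/
def hypercenter (G : Type*) [Group G] : Subgroup G := ⨆ n, Subgroup.upperCentralSeries G n

instance : (hypercenter G).Normal := Subgroup.iSup_normal _

theorem mem_hypercenter {g : G} :
    g ∈ hypercenter G ↔ ∃ n, g ∈ Subgroup.upperCentralSeries G n :=
  Subgroup.mem_iSup_of_directed (Subgroup.upperCentralSeries_mono G).directed_le

theorem exists_forall_mem_upperCentralSeries {ι : Type*} (T : Finset ι) {f : ι → G}
    (h : ∀ x ∈ T, f x ∈ hypercenter G) : ∃ n, ∀ x ∈ T, f x ∈ Subgroup.upperCentralSeries G n := by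
  choose! m hm using fun x hx => mem_hypercenter.1 (h x hx)
  exact ⟨T.sup m, fun x hx => Subgroup.upperCentralSeries_mono G (Finset.le_sup hx) (hm x hx)⟩

theorem mem_hypercenter_of_closure {T : Finset G} (hT : Subgroup.closure (T : Set G) = ⊤) {g : G}
    (h : ∀ x ∈ T, ⁅g, x⁆ ∈ hypercenter G) : g ∈ hypercenter G := by
  obtain ⟨n, hn⟩ := exists_forall_mem_upperCentralSeries T h
  exact mem_hypercenter.2 ⟨n + 1, mem_upperCentralSeries_succ_of_closure hT hn⟩

/-- Modulo the hypercenter, an element of `C` other than `1` has a nontrivial commutator with some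
generator, so greedy runs over the generators never reach `1`. -/
theorem IsSandwichSystem.isNilpotent {C : Set G} (hC : IsSandwichSystem C) {T : Finset G}
    (hTC : (T : Set G) ⊆ C) (hT : Subgroup.closure (T : Set G) = ⊤) : Group.IsNilpotent G := by
  let π := QuotientGroup.mk' (hypercenter G)
  have hπ : ∀ {g : G}, π g = 1 ↔ g ∈ hypercenter G := QuotientGroup.eq_one_iff _
  have hCπ := hC.map π
  have hL : ∀ x ∈ T.toList.map π, x ∈ π '' C := by
    intro x hx
    obtain ⟨y, hy, rfl⟩ := List.mem_map.1 hx
    exact ⟨y, hTC (Finset.mem_toList.1 hy), rfl⟩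
  have hstep : ∀ c ∈ π '' C, c ≠ 1 → step (T.toList.map π) c ≠ 1 := by
    rintro _ ⟨g, hg, rfl⟩ hne
    refine step_ne_one fun h => hne (hπ.2 (mem_hypercenter_of_closure hT fun x hx => ?_))
    rw [← hπ, map_commutatorElement, commutatorElement_eq_one_iff_commute]
    exact h _ (List.mem_map.2 ⟨x, Finset.mem_toList.2 hx, rfl⟩)
  have htriv : ∀ c ∈ π '' C, c = 1 := by
    by_contra! hne
    obtain ⟨c, hc, hc1⟩ := hne
    refine hCπ.not_long hL fun n => ⟨c, hc, ?_⟩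
    have : (step (T.toList.map π))^[n] c ∈ π '' C ∧ (step (T.toList.map π))^[n] c ≠ 1 := by
      induction n with
      | zero => exact ⟨hc, hc1⟩
      | succ n ih =>
        rw [Function.iterate_succ_apply']
        exact ⟨hCπ.step_mem hL ih.1, hstep _ ih.1 ih.2⟩
    exact this.2
  obtain ⟨n, hn⟩ := exists_forall_mem_upperCentralSeries T (f := id)
    fun x hx => hπ.1 (htriv _ ⟨x, hTC hx, rfl⟩)
  refine ⟨n, ?_⟩
  rw [eq_top_iff, ← hT, Subgroup.closure_le]
  exact hn

end Finish

end StrongSandwich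

theorem theorem1p1 (G : Type*) [Group G] (hfg : Group.FG G) (hG : IsStrongSandwichGroup G) :
    Group.IsNilpotent G := by
  obtain ⟨X, hX, hgen⟩ := hG
  obtain ⟨T, hTX, hT⟩ := StrongSandwich.exists_finset_closure_eq_top hfg hgen
  refine (StrongSandwich.isSandwichSystem_gen hX hgen).isNilpotent (fun x hx => ⟨0, ?_⟩) hT
  simpa using StrongSandwich.Gen.base (X := X) 1 (hTX hx)
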